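/- **Notation.** Let $$X=\begin{pmatrix}0&1\\1&0\end{pmatrix},\quad Z=\begin{pmatrix}1&0\\0&-1\end{pmatrix},\quad H=\tfrac1{\sqrt2}\begin{pmatrix}1&1\\1&-1\end{pmatrix},\quad CZ=\mathrm{diag}(1,1,1,-1).$$ For $n\ge 0$ the real Pauli group is $\mathcal P_n=\{\pm P_1\otimes\cdots\otimes P_n : P_i\in\{I,X,Z,XZ\}\}$ (so $\mathcal P_0=\{\pm1\}$), and the real Clifford group $\mathcal C_n$ is the normalizer of $\mathcal P_n$ in the orthogonal group $O(2^n)$. Write $U\bullet P=UPU^{-1}$. Circuits on $n$ wires (wire $1$ on top, the first tensor factor) are words in the gates $H$ and $Z$ on single wires and $CZ$ on two adjacent wires. Words are written in the order in which the gates are applied, so the operator of a word is the product of its gates with the first gate as the rightmost factor. For two adjacent wires let $t$, $b$ denote $H$ on the upper and on the lower wire, and $c$ denote $CZ$ on both. The *derived generators* are the following circuits, where the gates of kind $A$, $B$, $C$ have wires carrying a type, single ($s$) or double ($d$), and gates with different names are different even if their circuits agree: * $A_1=$ empty, $A_2=H$ (output type $s$), $A_3=$ empty (output type $d$); * $B_1=B_5=bcbtcbtc$,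 $B_2=B_6=cbtc$, $B_3=B_7=tcbtc$, $B_4=B_8=bcbcbtc$; the type of the lower input wire and the type of the upper output wire are $s\to s$ for $B_1,B_2,B_3$, $s\to d$ for $B_4$, $d\to d$ for $B_5,B_6,B_7$, $d\to s$ for $B_8$; * $C_1=$ empty, $C_2=HZH$ $(=X)$ (input type $s$); * $D_1=cbtcbtcb$, $D_2=tcbtcb$, $D_3=btcbtcb$, $D_4=tcbtcbc$; * $E_1=$ empty, $E_2=Z$. A *$Z$-circuit* on $n\ge1$ wires consists of a gate of kind $A$ on some wire $m\in\{1,\dots,n\}$, followed by gates of kind $B$ on the wires $(m-1,m),(m-2,m-1),\dots,(1,2)$ in this order, followed by a gate of kind $C$ on wire $1$, such that the output type of each gate equals the input type of the next one. An *$X$-circuit* on $n\ge 1$ wires consists of gates of kind $D$ on the wires $(1,2),(2,3),\dots,(n-1,n)$ in this order, followed by a gate of kind $E$ on wire $n$. *Normal circuits* are defined recursively: on $0$ wires they are the scalars $\pm1$; on $n\ge1$ wires they are the circuits $(C'\otimes I)\cdot M\cdot L$ with $L$ a $Z$-circuit and $M$ an $X$-circuit on $n$ wires, and $C'$ a normal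 circuit on the first $n-1$ wires. Thus a normal circuit is given by a scalar $\pm1$ and a choice of derived generators; $-C$ has the same generators as $C$ and the opposite scalar. **Proposition.** Let $n\ge0$. 1. For every group automorphism $\phi$ of $\mathcal P_n$ there is a normal circuit $C$ on $n$ wires such that $C\bullet P=\phi(P)$ for all $P\in\mathcal P_n$. It is unique up to the scalar $\pm1$: a normal circuit $D$ satisfies $D\bullet P=\phi(P)$ for all $P\in\mathcal P_n$ if and only if $D=C$ or $D=-C$ as circuits. 2. Every normal circuit on $n$ wires represents an element of $\mathcal C_n$, and every element of $\mathcal C_n$ is represented by exactly one normal circuit. 3. $\mathcal C_n$ is generated by $-1$, the gates $H$ and $Z$ on single wires, and the gates $CZ$ on pairs of adjacent wires. -/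

import Mathlib

namespace RealClifford

noncomputable section

/-- The orthogonal group `O(2ⁿ)`. Rows and columns are indexed by the computational basis, i.e. by
the bit strings `x : Fin n → Fin 2`, where `x i` is the value of qubit `i` (qubit `0` is the top
wire, the first tensor factor). -/
abbrev Ortho (n : ℕ) : Type := Matrix.orthogonalGroup (Fin n → Fin 2) ℝ

/-- The orthogonal group `O(2)` of a single qubit. -/
abbrev Ortho₂ : Type := Matrix.orthogonalGroup (Fin 2) ℝ

theorem coe_neg_ortho {ι : Type} [Fintype ι] [DecidableEq ι] (U : Matrix.orthogonalGroup ι ℝ) :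
    ((-U : Matrix.orthogonalGroup ι ℝ) : Matrix ι ι ℝ) = -(U : Matrix ι ι ℝ) := rfl

/-- The matrix of `A₀ ⊗ A₁ ⊗ ⋯ ⊗ Aₙ₋₁`. -/
def tensorMatrix {n : ℕ} (A : Fin n → Matrix (Fin 2) (Fin 2) ℝ) :
    Matrix (Fin n → Fin 2) (Fin n → Fin 2) ℝ :=
  Matrix.of fun x y => ∏ i, A i (x i) (y i)

theorem tensorMatrix_mul {n : ℕ} (A B : Fin n → Matrix (Fin 2) (Fin 2) ℝ) :
    tensorMatrix A * tensorMatrix B = tensorMatrix fun i => A i * B i := by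
  ext x y
  simp only [tensorMatrix, Matrix.mul_apply, Matrix.of_apply, ← Finset.prod_mul_distrib]
  rw [Finset.prod_univ_sum, Fintype.piFinset_univ]

theorem tensorMatrix_one {n : ℕ} :
    tensorMatrix (fun _ : Fin n => (1 : Matrix (Fin 2) (Fin 2) ℝ)) = 1 := by
  ext x y
  simp only [tensorMatrix, Matrix.of_apply, Matrix.one_apply, Finset.prod_boole, Finset.mem_univ,
    true_implies, funext_iff]

theorem tensorMatrix_transpose {n : ℕ} (A : Fin n → Matrix (Fin 2) (Fin 2) ℝ) :
    (tensorMatrix A).transpose = tensorMatrix fun i => (A i).transpose := by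
  ext x y
  simp [tensorMatrix, Matrix.transpose_apply]

/-- The tensor product `A₀ ⊗ A₁ ⊗ ⋯ ⊗ Aₙ₋₁` of one-qubit operators. -/
def tensor {n : ℕ} (A : Fin n → Ortho₂) : Ortho n :=
  ⟨tensorMatrix fun i => (A i : Matrix (Fin 2) (Fin 2) ℝ), by
    rw [Matrix.mem_orthogonalGroup_iff, tensorMatrix_transpose, tensorMatrix_mul,
      ← tensorMatrix_one]
    congr 1
    funext i
    exact (Matrix.mem_orthogonalGroup_iff (Fin 2) ℝ).1 (A i).2⟩

theorem tensor_mul {n : ℕ} (A B : Fin n → Ortho₂) :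
    tensor A * tensor B = tensor fun i => A i * B i :=
  Subtype.ext (tensorMatrix_mul _ _)

theorem tensor_one {n : ℕ} : tensor (fun _ : Fin n => (1 : Ortho₂)) = 1 :=
  Subtype.ext tensorMatrix_one

theorem tensor_inv {n : ℕ} (A : Fin n → Ortho₂) : (tensor A)⁻¹ = tensor fun i => (A i)⁻¹ := by
  rw [inv_eq_iff_mul_eq_one, tensor_mul]
  simp [tensor_one]

/-- The Pauli matrix `X`. -/
def pauliX : Ortho₂ :=
  ⟨!![0, 1; 1, 0], by
    rw [Matrix.mem_orthogonalGroup_iff]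
    ext i j
    fin_cases i <;> fin_cases j <;> simp [Matrix.mul_apply]⟩

/-- The Pauli matrix `Z`. -/
def pauliZ : Ortho₂ :=
  ⟨!![1, 0; 0, -1], by
    rw [Matrix.mem_orthogonalGroup_iff]
    ext i j
    fin_cases i <;> fin_cases j <;> simp [Matrix.mul_apply]⟩

/-- The Hadamard matrix `H`. -/
def hadamard : Ortho₂ :=
  ⟨(1 / Real.sqrt 2) • !![1, 1; 1, -1], by
    have h : (Real.sqrt 2)⁻¹ * (Real.sqrt 2)⁻¹ = (1 / 2 : ℝ) := by
      rw [← mul_inv, Real.mul_self_sqrt (by norm_num)]; norm_num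
    rw [Matrix.mem_orthogonalGroup_iff]
    ext i j
    fin_cases i <;> fin_cases j <;> simp [Matrix.mul_apply, h] <;> norm_num⟩

theorem pauliX_mul_self : pauliX * pauliX = 1 := by
  ext i j
  fin_cases i <;> fin_cases j <;> simp [pauliX]

theorem pauliZ_mul_self : pauliZ * pauliZ = 1 := by
  ext i j
  fin_cases i <;> fin_cases j <;> simp [pauliZ]

theorem pauliZ_mul_pauliX : pauliZ * pauliX = -(pauliX * pauliZ) := by
  ext i j
  fin_cases i <;> fin_cases j <;> simp [coe_neg_ortho, pauliX, pauliZ]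

/-- The set `{I, X, Z, XZ}`. -/
def pauliLetters : Set Ortho₂ := {1, pauliX, pauliZ, pauliX * pauliZ}

theorem exists_letter_mul {P Q : Ortho₂} (hP : P ∈ pauliLetters) (hQ : Q ∈ pauliLetters) :
    ∃ R ∈ pauliLetters, P * Q = R ∨ P * Q = -R := by
  have hx := pauliX_mul_self
  have hz := pauliZ_mul_self
  have hzx := pauliZ_mul_pauliX
  have hx' : ∀ A : Ortho₂, pauliX * (pauliX * A) = A := fun A => by rw [← mul_assoc, hx, one_mul]
  have hzx' : ∀ A : Ortho₂, pauliZ * (pauliX * A) = -(pauliX * (pauliZ * A)) := fun A => by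
    rw [← mul_assoc, hzx, neg_mul, mul_assoc]
  rcases hP with rfl | rfl | rfl | rfl <;> rcases hQ with rfl | rfl | rfl | rfl
  all_goals
    simp only [pauliLetters, Set.mem_insert_iff, Set.mem_singleton_iff, exists_eq_or_imp,
      exists_eq_left, one_mul, mul_one, mul_assoc, hx, hz, hzx, hx', hzx', mul_neg]
    simp

theorem exists_letter_inv {P : Ortho₂} (hP : P ∈ pauliLetters) :
    ∃ R ∈ pauliLetters, P⁻¹ = R ∨ P⁻¹ = -R := by
  have hx : pauliX⁻¹ = pauliX := inv_eq_of_mul_eq_one_left pauliX_mul_self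
  have hz : pauliZ⁻¹ = pauliZ := inv_eq_of_mul_eq_one_left pauliZ_mul_self
  rcases hP with rfl | rfl | rfl | rfl
  all_goals
    simp only [pauliLetters, Set.mem_insert_iff, Set.mem_singleton_iff, exists_eq_or_imp,
      exists_eq_left, mul_inv_rev, inv_one, hx, hz, pauliZ_mul_pauliX]
    simp

theorem tensor_eq_or_neg {n : ℕ} (A R : Fin n → Ortho₂) (h : ∀ i, A i = R i ∨ A i = -R i) :
    tensor A = tensor R ∨ tensor A = -tensor R := by
  have key : ∀ x y : Fin n → Fin 2, ∀ s : Finset (Fin n),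
      ∏ i ∈ s, (A i : Matrix (Fin 2) (Fin 2) ℝ) (x i) (y i) =
        (∏ i ∈ s, if A i = R i then (1 : ℝ) else -1) *
          ∏ i ∈ s, (R i : Matrix (Fin 2) (Fin 2) ℝ) (x i) (y i) := by
    intro x y s
    rw [← Finset.prod_mul_distrib]
    refine Finset.prod_congr rfl fun i _ => ?_
    split_ifs with hi
    · rw [hi, one_mul]
    · rw [(h i).resolve_left hi, coe_neg_ortho]
      simp
  have hs : (∏ i, if A i = R i then (1 : ℝ) else -1) = 1 ∨
      (∏ i, if A i = R i then (1 : ℝ) else -1) = -1 := by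
    refine Finset.prod_induction _ (fun r : ℝ => r = 1 ∨ r = -1) ?_ (Or.inl rfl) ?_
    · rintro a b (rfl | rfl) (rfl | rfl) <;> simp
    · intro i _
      split_ifs <;> simp
  rcases hs with hs | hs
  · left
    ext x y
    simp [tensor, tensorMatrix, key x y, hs]
  · right
    ext x y
    simp [coe_neg_ortho, tensor, tensorMatrix, key x y, hs]

/-- The real Pauli group on `n` qubits:
all `±(P₁ ⊗ ⋯ ⊗ Pₙ)` with every `Pᵢ` in `{I, X, Z, XZ}`. -/
def pauliGroup (n : ℕ) : Subgroup (Ortho n) where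
  carrier := {U | ∃ P : Fin n → Ortho₂, (∀ i, P i ∈ pauliLetters) ∧
    (U = tensor P ∨ U = -tensor P)}
  one_mem' := ⟨fun _ => 1, fun _ => Or.inl rfl, Or.inl tensor_one.symm⟩
  mul_mem' := by
    rintro U V ⟨P, hP, hU⟩ ⟨Q, hQ, hV⟩
    choose R hR hPQ using fun i => exists_letter_mul (hP i) (hQ i)
    refine ⟨R, hR, ?_⟩
    have h := tensor_eq_or_neg (fun i => P i * Q i) R hPQ
    rw [← tensor_mul] at h
    rcases hU with rfl | rfl <;> rcases hV with rfl | rfl <;> rcases h with h | h <;> simp [h]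
  inv_mem' := by
    rintro U ⟨P, hP, hU⟩
    choose R hR hPR using fun i => exists_letter_inv (hP i)
    refine ⟨R, hR, ?_⟩
    have h := tensor_eq_or_neg (fun i => (P i)⁻¹) R hPR
    rw [← tensor_inv] at h
    have hn : ∀ V : Ortho n, (-V)⁻¹ = -V⁻¹ := fun V => by
      rw [inv_eq_iff_mul_eq_one]; simp
    rcases hU with rfl | rfl <;> rcases h with h | h <;> simp [h, hn]

/-- The real Clifford group on `n` qubits: the normalizer of the real Pauli group in `O(2ⁿ)`. -/
def cliffordGroup (n : ℕ) : Subgroup (Ortho n) :=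
  Subgroup.normalizer (pauliGroup n : Set (Ortho n))

/-! ### Circuits over `H`, `Z` and `CZ` -/

/-- The gate `I ⊗ ⋯ ⊗ I ⊗ G ⊗ I ⊗ ⋯ ⊗ I` with `G` on wire `i`. -/
def onWire {n : ℕ} (i : Fin n) (G : Ortho₂) : Ortho n :=
  tensor (Function.update (fun _ => 1) i G)

/-- The gate `I ⊗ ⋯ ⊗ I ⊗ CZ ⊗ I ⊗ ⋯ ⊗ I` on the wires `i` and `j`: the diagonal operator that
flips the sign of exactly those basis vectors in which the qubits `i` and `j` are both `1`. -/
def controlledZ {n : ℕ} (i j : Fin n) : Ortho n :=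
  ⟨Matrix.diagonal fun x => if x i = 1 ∧ x j = 1 then -1 else 1, by
    rw [Matrix.mem_orthogonalGroup_iff, Matrix.diagonal_transpose, Matrix.diagonal_mul_diagonal,
      ← Matrix.diagonal_one]
    congr 1
    funext x
    split_ifs <;> simp⟩

/-- The elementary gates on `n` wires; `CZ i` acts on the adjacent wires `i` and `i + 1`. -/
inductive Gate (n : ℕ) : Type
  | H (i : Fin n) : Gate n
  | Z (i : Fin n) : Gate n
  | CZ (i : ℕ) (h : i + 1 < n) : Gate n

/-- The operator of an elementary gate. -/
def Gate.op {n : ℕ} : Gate n → Ortho n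
  | .H i => onWire i hadamard
  | .Z i => onWire i pauliZ
  | .CZ i h => controlledZ ⟨i, by omega⟩ ⟨i + 1, h⟩

/-- The same gate, on the first `n` of `n + 1` wires. -/
def Gate.castSucc {n : ℕ} : Gate n → Gate (n + 1)
  | .H i => .H i.castSucc
  | .Z i => .Z i.castSucc
  | .CZ i h => .CZ i (by omega)

/-- A circuit, read from left to right: the head of the list is applied first. -/
abbrev Circuit (n : ℕ) : Type := List (Gate n)

/-- The operator of a circuit. The gate applied first is the rightmost factor. -/
def Circuit.op {n : ℕ} : Circuit n → Ortho n
  | [] => 1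
  | g :: w => Circuit.op w * g.op

/-! ### Typed derived generators -/

/-- The two distinguished types of wires, which restrict how the derived generators may be composed.
The remaining wires of the derived generators impose no restriction and carry no type. -/
inductive WireType : Type
  | single
  | double

open WireType

/-- Derived generators of kind `A`, indexed by the type of the output wire. -/
inductive GateA : WireType → Type
  | A1 : GateA single
  | A2 : GateA single
  | A3 : GateA double

/-- Derived generators of kind `B`, indexed by the type of the bottom input wire and the type of
the top output wire. -/
inductive GateB : WireType → WireType → Type
  | B1 : GateB single single
  | B2 : GateB single single
  | B3 : GateB single single
  | B4 : GateB single double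
  | B5 : GateB double double
  | B6 : GateB double double
  | B7 : GateB double double
  | B8 : GateB double single

/-- Derived generators of kind `C`; their input wire is of single type. -/
inductive GateC : Type
  | C1
  | C2

/-- Derived generators of kind `D`. -/
inductive GateD : Type
  | D1
  | D2
  | D3
  | D4

/-- Derived generators of kind `E`. -/
inductive GateE : Type
  | E1
  | E2

/-- The circuit of an `A` gate on wire `i`. -/
def GateA.circuit {n : ℕ} {t : WireType} (i : Fin n) : GateA t → Circuit n
  | .A1 => []
  | .A2 => [.H i]
  | .A3 => []

/-- The circuit of a `B` gate on the wires `i` (top) and `i + 1` (bottom). -/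
def GateB.circuit {n : ℕ} {t u : WireType} (i : ℕ) (h : i + 1 < n) (b : GateB t u) : Circuit n :=
  let top : Fin n := ⟨i, by omega⟩
  let bot : Fin n := ⟨i + 1, h⟩
  match b with
  | .B1 | .B5 => [.H bot, .CZ i h, .H bot, .H top, .CZ i h, .H bot, .H top, .CZ i h]
  | .B2 | .B6 => [.CZ i h, .H bot, .H top, .CZ i h]
  | .B3 | .B7 => [.H top, .CZ i h, .H bot, .H top, .CZ i h]
  | .B4 | .B8 => [.H bot, .CZ i h, .H bot, .CZ i h, .H bot, .H top, .CZ i h]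

/-- The circuit of a `C` gate on wire `i`: nothing, or the gate `X = HZH`. -/
def GateC.circuit {n : ℕ} (i : Fin n) : GateC → Circuit n
  | .C1 => []
  | .C2 => [.H i, .Z i, .H i]

/-- The circuit of a `D` gate on the wires `i` (top) and `i + 1` (bottom). -/
def GateD.circuit {n : ℕ} (i : ℕ) (h : i + 1 < n) (d : GateD) : Circuit n :=
  let top : Fin n := ⟨i, by omega⟩
  let bot : Fin n := ⟨i + 1, h⟩
  match d with
  | .D1 => [.CZ i h, .H bot, .H top, .CZ i h, .H bot, .H top, .CZ i h, .H bot]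
  | .D2 => [.H top, .CZ i h, .H bot, .H top, .CZ i h, .H bot]
  | .D3 => [.H bot, .H top, .CZ i h, .H bot, .H top, .CZ i h, .H bot]
  | .D4 => [.H top, .CZ i h, .H bot, .H top, .CZ i h, .H bot, .CZ i h]

/-- The circuit of an `E` gate on wire `i`. -/
def GateE.circuit {n : ℕ} (i : Fin n) : GateE → Circuit n
  | .E1 => []
  | .E2 => [.Z i]

/-! ### Normal circuits -/

/-- A well-typed ladder of `B` gates that starts on wire `k`, entering with type `t`, climbs wire
by wire to wire `0`, and leaves wire `0` with single type. -/
inductive BLadder : ℕ → WireType → Type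
  | nil : BLadder 0 single
  | cons {k : ℕ} {t u : WireType} (b : GateB t u) (l : BLadder k u) : BLadder (k + 1) t

/-- The circuit of a ladder of `B` gates on `n` wires. -/
def BLadder.circuit (n : ℕ) : {k : ℕ} → {t : WireType} → BLadder k t → k < n → Circuit n
  | _, _, .nil, _ => []
  | _, _, .cons (k := k) b l, h => b.circuit k h ++ l.circuit n (by omega)

/-- A `Z`-circuit on `n + 1` qubits: an `A` gate on some wire `m`, a ladder of `B` gates from wire
`m` up to the top wire, and a `C` gate on the top wire. -/
structure ZCircuit (n : ℕ) : Type where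
  m : Fin (n + 1)
  t : WireType
  a : GateA t
  ladder : BLadder m t
  c : GateC

/-- The underlying circuit of a `Z`-circuit. -/
def ZCircuit.circuit {n : ℕ} (L : ZCircuit n) : Circuit (n + 1) :=
  L.a.circuit L.m ++ L.ladder.circuit (n + 1) L.m.isLt ++ L.c.circuit 0

/-- An `X`-circuit on `n + 1` qubits: `D` gates on the wires `(0, 1), (1, 2), …, (n - 1, n)`, in
this order, and an `E` gate on the bottom wire `n`. -/
structure XCircuit (n : ℕ) : Type where
  d : Fin n → GateD
  e : GateE

/-- The underlying circuit of an `X`-circuit. -/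
def XCircuit.circuit {n : ℕ} (M : XCircuit n) : Circuit (n + 1) :=
  (List.finRange n).flatMap (fun i => (M.d i).circuit i.val (by omega)) ++
    M.e.circuit (Fin.last n)

/-- A normal circuit without its scalar. On `n + 1` qubits it is `(C' ⊗ I) · M · L`, with `L` a
`Z`-circuit, `M` an `X`-circuit, and `C'` such a circuit on the first `n` qubits. -/
inductive NormalBody : ℕ → Type
  | nil : NormalBody 0
  | step {n : ℕ} (C' : NormalBody n) (M : XCircuit n) (L : ZCircuit n) : NormalBody (n + 1)

/-- The underlying circuit: first `L`, then `M`, then `C'` on the first `n` wires. -/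
def NormalBody.circuit : {n : ℕ} → NormalBody n → Circuit n
  | _, .nil => []
  | _, .step C' M L => L.circuit ++ M.circuit ++ C'.circuit.map Gate.castSucc

/-- A normal circuit on `n` qubits: a body, together with a scalar `±1`, which is `-1` if
`negative` is true. -/
@[ext]
structure NormalCircuit (n : ℕ) : Type where
  negative : Bool
  body : NormalBody n

/-- The operator of a normal circuit. -/
def NormalCircuit.op {n : ℕ} (C : NormalCircuit n) : Ortho n :=
  if C.negative then -C.body.circuit.op else C.body.circuit.op

/-- The normal circuit `(-1) · C`: the same gates with the opposite scalar. -/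
instance (n : ℕ) : Neg (NormalCircuit n) := ⟨fun C => ⟨!C.negative, C.body⟩⟩

/-- `C • P = φ(P)` for every Pauli operator `P`, where `C • P = C P C⁻¹`. -/
def NormalCircuit.Realizes {n : ℕ} (C : NormalCircuit n) (φ : pauliGroup n ≃* pauliGroup n) :
    Prop :=
  ∀ P : pauliGroup n, C.op * (P : Ortho n) * C.op⁻¹ = (φ P : Ortho n)

end

end RealClifford

/-!
Up to its sign, a Pauli operator is given by the exponents of `X` and `Z` on each wire, and
conjugation by a gate acts on signs and exponents by explicit formulas. An automorphism `φ` of the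
Pauli group on `n + 1` wires is determined by its restriction to operators on the first `n` wires
together with the preimages `a` and `b` of `Z` and `X` on the last wire. Exactly one `Z`-circuit `L`
takes `a` to `Z` on the first wire: at each step the letters already present dictate the next gate
of the ladder. Every `X`-circuit carries this `Z` to the last wire, and exactly one of them, `M`,
takes the image of `b` under `L`, which anticommutes with `Z` on the first wire, to `X` on the last
wire. What remains of `φ` after `M * L` fixes `X` and `Z` on the last wire, hence comes from an
automorphism for `n` wires, and one concludes by induction. By Schur's lemma an operator is
determined up to sign by its action on the Pauli group, so the statements about Clifford operators
follow from the one about automorphisms.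
-/

namespace RealClifford

open WireType Matrix
open scoped Fin.CommRing

/-- The sign `(-1) ^ s` of a bit `s`. -/
def sgn {M : Type*} [Monoid M] [HasDistribNeg M] : AddChar (Fin 2) M where
  toFun s := (-1) ^ (s : ℕ)
  map_zero_eq_one' := pow_zero _
  map_add_eq_mul' s t := by fin_cases s <;> fin_cases t <;> simp

section Sign

variable {M : Type*} [Monoid M] [HasDistribNeg M]

theorem sgn_one : (sgn 1 : M) = -1 := pow_one _

theorem sgn_commute (s : Fin 2) (a : M) : Commute (sgn s) a :=
  (Commute.neg_one_left a).pow_left _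

theorem coe_sgn_mul {ι : Type} [Fintype ι] [DecidableEq ι] (s : Fin 2)
    (U : Matrix.orthogonalGroup ι ℝ) :
    ((sgn s * U : Matrix.orthogonalGroup ι ℝ) : Matrix ι ι ℝ) = (sgn s : ℝ) • U.1 := by
  fin_cases s <;> simp [sgn_one, coe_neg_ortho]

theorem sgn_injective : Function.Injective (sgn : Fin 2 → ℝ) := by
  intro s t h
  fin_cases s <;> fin_cases t <;> first | rfl | norm_num [sgn_one] at h

theorem sgn_sum {ι : Type*} (I : Finset ι) (f : ι → Fin 2) :
    (sgn (∑ i ∈ I, f i) : ℝ) = ∏ i ∈ I, sgn (f i) :=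
  map_prod (sgn : AddChar (Fin 2) ℝ).toMonoidHom (fun i => Multiplicative.ofAdd (f i)) I

end Sign

theorem bits_add_self {ι : Type*} (u : ι → Fin 2) : u + u = 0 :=
  funext fun i => CharTwo.add_self_eq_zero (u i)

/-- The operator `(-1) ^ sign • ⨂ᵢ X ^ x i * Z ^ z i`, given by its exponents. -/
@[ext]
structure PauliString (n : ℕ) : Type where
  sign : Fin 2
  x : Fin n → Fin 2
  z : Fin n → Fin 2
deriving Fintype

namespace PauliString

variable {n : ℕ}

instance : One (PauliString n) := ⟨⟨0, 0, 0⟩⟩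

-- The last summand of the sign comes from moving `Z ^ p.z` past `X ^ q.x`.
instance : Mul (PauliString n) :=
  ⟨fun p q => ⟨p.sign + q.sign + p.z ⬝ᵥ q.x, p.x + q.x, p.z + q.z⟩⟩

instance : Inv (PauliString n) := ⟨fun p => ⟨p.sign + p.z ⬝ᵥ p.x, p.x, p.z⟩⟩

@[simp] theorem one_sign : (1 : PauliString n).sign = 0 := rfl
@[simp] theorem one_x : (1 : PauliString n).x = 0 := rfl
@[simp] theorem one_z : (1 : PauliString n).z = 0 := rfl

@[simp] theorem mul_sign (p q : PauliString n) :
    (p * q).sign = p.sign + q.sign + p.z ⬝ᵥ q.x := rfl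

@[simp] theorem mul_x (p q : PauliString n) : (p * q).x = p.x + q.x := rfl
@[simp] theorem mul_z (p q : PauliString n) : (p * q).z = p.z + q.z := rfl

@[simp] theorem inv_sign (p : PauliString n) : p⁻¹.sign = p.sign + p.z ⬝ᵥ p.x := rfl
@[simp] theorem inv_z (p : PauliString n) : p⁻¹.z = p.z := rfl

instance : Group (PauliString n) := Group.ofLeftAxioms
  (fun p q r => by
    ext : 1
    · simp only [mul_sign, mul_x, mul_z, add_dotProduct, dotProduct_add]
      abel
    · exact add_assoc _ _ _
    · exact add_assoc _ _ _)
  (fun p => by ext : 1 <;> simp)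
  (fun p => by
    ext : 1
    · simp only [mul_sign, inv_sign, inv_z, add_right_comm, CharTwo.add_self_eq_zero, zero_add,
        one_sign]
    · exact bits_add_self p.x
    · exact bits_add_self p.z)

/-- The operator `X ^ a * Z ^ b` on one qubit. -/
noncomputable def letterOp (a b : Fin 2) : Ortho₂ :=
  pauliX ^ (a : ℕ) * pauliZ ^ (b : ℕ)

theorem letterOp_apply (a b x y : Fin 2) :
    (letterOp a b).1 x y = if x = y + a then sgn (b * y) else 0 := by
  fin_cases a <;> fin_cases b <;> fin_cases x <;> fin_cases y <;>
    simp [letterOp, pauliX, pauliZ, sgn_one]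

theorem mem_pauliLetters_iff {P : Ortho₂} : P ∈ pauliLetters ↔ ∃ a b, letterOp a b = P := by
  simp [pauliLetters, letterOp, Fin.exists_fin_two, eq_comm, or_assoc, or_left_comm]

/-- The Pauli operator with the exponents `p`. -/
noncomputable def op (p : PauliString n) : Ortho n :=
  sgn p.sign * tensor fun i => letterOp (p.x i) (p.z i)

theorem op_apply (p : PauliString n) (u v : Fin n → Fin 2) :
    p.op.1 u v = if u = v + p.x then sgn (p.sign + p.z ⬝ᵥ v) else 0 := by
  simp only [op, coe_sgn_mul, tensor, tensorMatrix, Matrix.smul_apply, Matrix.of_apply,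
    letterOp_apply, Fintype.prod_ite_zero, ← sgn_sum, AddChar.map_add_eq_mul, smul_eq_mul,
    mul_ite, mul_zero, dotProduct, funext_iff, Pi.add_apply]

theorem mul_op_apply (A : Matrix (Fin n → Fin 2) (Fin n → Fin 2) ℝ) (p : PauliString n)
    (u v : Fin n → Fin 2) :
    (A * p.op.1) u v = A u (v + p.x) * sgn (p.sign + p.z ⬝ᵥ v) := by
  simp only [Matrix.mul_apply, op_apply, mul_ite, mul_zero, Finset.sum_ite_eq',
    Finset.mem_univ, if_true]

theorem op_mul_apply (A : Matrix (Fin n → Fin 2) (Fin n → Fin 2) ℝ) (p : PauliString n)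
    (u v : Fin n → Fin 2) :
    (p.op.1 * A) u v = sgn (p.sign + p.z ⬝ᵥ (u + p.x)) * A (u + p.x) v := by
  have h (w : Fin n → Fin 2) : u = w + p.x ↔ w = u + p.x := by
    constructor <;> rintro rfl <;> rw [add_assoc, bits_add_self, add_zero]
  simp only [Matrix.mul_apply, op_apply, h, ite_mul, zero_mul, Finset.sum_ite_eq',
    Finset.mem_univ, if_true]

/-- Reading off the operator of a Pauli string is a homomorphism. -/
noncomputable def opHom (n : ℕ) : PauliString n →* Ortho n := MonoidHom.mk' op fun p q => by
  ext u v
  rw [Submonoid.coe_mul, mul_op_apply, op_apply, op_apply]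
  simp only [mul_x, mul_z, mul_sign, ← add_assoc, add_right_comm v, ite_mul, zero_mul,
    add_dotProduct, dotProduct_add, ← AddChar.map_add_eq_mul]
  congr 2
  abel

theorem op_mul (p q : PauliString n) : (p * q).op = p.op * q.op := map_mul (opHom n) p q

theorem op_injective : Function.Injective (op : PauliString n → Ortho n) := by
  refine (injective_iff_map_eq_one (opHom n)).2 fun p hp => ?_
  have entry (v : Fin n → Fin 2) : p.op.1 v v = 1 := by
    rw [show p.op = 1 from hp]; simp
  simp only [op_apply, left_eq_add] at entry
  have hx : p.x = 0 := by
    by_contra h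
    simpa [h] using entry 0
  have hs (v : Fin n → Fin 2) : p.sign + p.z ⬝ᵥ v = 0 :=
    sgn_injective (by simpa [hx] using entry v)
  have h0 : p.sign = 0 := by simpa using hs 0
  ext : 1
  · exact h0
  · exact hx
  · exact funext fun i => by simpa [h0] using hs (Pi.single i 1)

theorem range_opHom : (opHom n).range = pauliGroup n := by
  ext U
  constructor
  · rintro ⟨⟨s, x, z⟩, rfl⟩
    refine ⟨fun i => letterOp (x i) (z i), fun i => mem_pauliLetters_iff.2 ⟨_, _, rfl⟩, ?_⟩
    fin_cases s <;> simp [opHom, op, sgn_one]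
  · rintro ⟨P, hP, hU⟩
    choose x z hxz using fun i => mem_pauliLetters_iff.1 (hP i)
    obtain rfl : (fun i => letterOp (x i) (z i)) = P := funext hxz
    rcases hU with rfl | rfl
    · exact ⟨⟨0, x, z⟩, by simp [opHom, op]⟩
    · exact ⟨⟨1, x, z⟩, by simp [opHom, op, sgn_one]⟩

/-- The real Pauli group consists of the operators of Pauli strings. -/
noncomputable def pauliEquiv (n : ℕ) : PauliString n ≃* pauliGroup n :=
  (MonoidHom.ofInjective (f := opHom n) op_injective).trans (MulEquiv.subgroupCongr range_opHom)

theorem coe_pauliEquiv (p : PauliString n) : (pauliEquiv n p : Ortho n) = p.op := rfl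

/-- The generator `X` on wire `i`. -/
def X (i : Fin n) : PauliString n := ⟨0, Pi.single i 1, 0⟩

/-- The generator `Z` on wire `i`. -/
def Z (i : Fin n) : PauliString n := ⟨0, 0, Pi.single i 1⟩

/-- Schur's lemma for the Pauli group: the strings `Z i` force a matrix to be diagonal, and the
`X`-strings then force its diagonal to be constant. -/
theorem eq_smul_one_of_commute (A : Matrix (Fin n → Fin 2) (Fin n → Fin 2) ℝ)
    (hA : ∀ p : PauliString n, Commute A p.op.1) : A = A 0 0 • 1 := by
  have entry (p : PauliString n) (u v : Fin n → Fin 2) := by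
    simpa only [mul_op_apply, op_mul_apply] using congr_fun₂ (hA p).eq u v
  ext u v
  rcases eq_or_ne u v with rfl | huv
  · simpa [bits_add_self] using entry ⟨0, u, 0⟩ u 0
  · obtain ⟨i, hi⟩ := Function.ne_iff.1 huv
    have : A u v * sgn (v i) = sgn (u i) * A u v := by simpa [Z] using entry (Z i) u v
    rw [mul_comm, mul_eq_mul_right_iff, sgn_injective.eq_iff] at this
    simpa [huv] using this.resolve_left hi.symm

theorem eq_one_or_eq_neg_one_of_commute (U : Ortho n)
    (hU : ∀ p : PauliString n, Commute U p.op) : U = 1 ∨ U = -1 := by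
  have scalar := eq_smul_one_of_commute U.1 fun p => congr_arg Subtype.val (hU p).eq
  have unit : (U.1 0 0) * U.1 0 0 = 1 := by
    have := congr_fun₂ ((Matrix.mem_orthogonalGroup_iff _ ℝ).1 U.2) 0 0
    rw [scalar] at this
    simpa using this
  rcases mul_self_eq_one_iff.1 unit with h | h <;> rw [h] at scalar
  · exact Or.inl (Subtype.ext (by simpa using scalar))
  · exact Or.inr (Subtype.ext (by simpa [coe_neg_ortho] using scalar))

theorem eq_or_eq_neg_of_conj_op_eq {U V : Ortho n}
    (h : ∀ p : PauliString n, U * p.op * U⁻¹ = V * p.op * V⁻¹) : U = V ∨ U = -V := by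
  have commute (p : PauliString n) : Commute (V⁻¹ * U) p.op := by
    simpa [commute_iff_eq, mul_assoc] using congr_arg (V⁻¹ * · * U) (h p)
  rcases eq_one_or_eq_neg_one_of_commute _ commute with h | h
  · exact Or.inl (inv_mul_eq_one.1 h).symm
  · exact Or.inr (by rw [← mul_neg_one, ← h, mul_inv_cancel_left])

theorem ortho_ne_neg (U : Ortho n) : U ≠ -U := by
  intro h
  have one_eq : (1 : Ortho n) = -1 := mul_left_cancel (a := U) (by rwa [mul_one, mul_neg_one])
  have := congr_fun₂ (congr_arg Subtype.val one_eq) 0 0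
  norm_num [coe_neg_ortho] at this

end PauliString

open PauliString

section Gates

variable {n : ℕ}

theorem onWire_sgn (i : Fin n) (s : Fin 2) : onWire i (sgn s) = sgn s := by
  have entry (u v : Fin n → Fin 2) (j : Fin n) :
      (Function.update (fun _ => (1 : Ortho₂)) i (sgn s) j).1 (u j) (v j) =
        (if j = i then sgn s else 1) * (1 : Matrix (Fin 2) (Fin 2) ℝ) (u j) (v j) := by
    rcases eq_or_ne j i with rfl | hj
    · rw [Function.update_self, ← mul_one (sgn s), coe_sgn_mul]
      simp
    · simp [hj]
  ext u v
  rw [← mul_one (sgn s : Ortho n), coe_sgn_mul, ← tensor_one]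
  simp only [onWire, tensor, tensorMatrix, entry, Finset.prod_mul_distrib]
  simp

theorem onWire_mul_op (i : Fin n) (G : Ortho₂) (p : PauliString n) {s a b : Fin 2}
    (h : G * letterOp (p.x i) (p.z i) = sgn s * letterOp a b * G) :
    onWire i G * p.op =
      op ⟨p.sign + s, Function.update p.x i a, Function.update p.z i b⟩ * onWire i G := by
  have tensor_eq : onWire i G * tensor (fun j => letterOp (p.x j) (p.z j)) = onWire i (sgn s) *
      tensor (fun j => letterOp (Function.update p.x i a j) (Function.update p.z i b j)) *
        onWire i G := by
    simp only [onWire, tensor_mul]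
    congr 1
    ext1 j
    rcases eq_or_ne j i with rfl | hj
    · simpa using h
    · simp [hj]
  rw [op, ← mul_assoc, ← (sgn_commute _ _).eq, mul_assoc, tensor_eq, onWire_sgn, op,
    AddChar.map_add_eq_mul]
  simp only [mul_assoc]

theorem hadamard_mul_letterOp (a b : Fin 2) :
    hadamard * letterOp a b = sgn (a * b) * letterOp b a * hadamard := by
  ext u v
  rw [mul_assoc, coe_sgn_mul]
  fin_cases a <;> fin_cases b <;> fin_cases u <;> fin_cases v <;>
    simp [letterOp, hadamard, pauliX, pauliZ, sgn_one]

theorem pauliZ_mul_letterOp (a b : Fin 2) :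
    pauliZ * letterOp a b = sgn a * letterOp a b * pauliZ := by
  ext u v
  rw [mul_assoc, coe_sgn_mul]
  fin_cases a <;> fin_cases b <;> fin_cases u <;> fin_cases v <;>
    simp [letterOp, pauliX, pauliZ, sgn_one]

theorem controlledZ_mul_op (i j : Fin n) (p : PauliString n) :
    controlledZ i j * p.op =
      op ⟨p.sign + p.x i * p.x j, p.x, p.z + Pi.single i (p.x j) + Pi.single j (p.x i)⟩ *
        controlledZ i j := by
  have diagonal : (controlledZ i j).1 = Matrix.diagonal fun u => (sgn (u i * u j) : ℝ) := by
    simp only [controlledZ]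
    congr! 2 with u
    generalize u i = a
    generalize u j = b
    fin_cases a <;> fin_cases b <;> simp [sgn_one]
  ext u v
  simp only [Submonoid.coe_mul, diagonal, Matrix.diagonal_mul, Matrix.mul_diagonal, op_apply]
  split_ifs with huv
  · simp only [huv, ← AddChar.map_add_eq_mul, Pi.add_apply, add_dotProduct, single_dotProduct]
    ring_nf
  · simp

/-- The action of a gate on Pauli strings by conjugation. -/
def Gate.conj : Gate n → PauliString n → PauliString n
  | .H i, p => ⟨p.sign + p.x i * p.z i, Function.update p.x i (p.z i),
      Function.update p.z i (p.x i)⟩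
  | .Z i, p => ⟨p.sign + p.x i, p.x, p.z⟩
  | .CZ i h, p =>
      let top : Fin n := ⟨i, by omega⟩
      let bot : Fin n := ⟨i + 1, h⟩
      ⟨p.sign + p.x top * p.x bot, p.x,
        p.z + Pi.single top (p.x bot) + Pi.single bot (p.x top)⟩

theorem Gate.op_conj (g : Gate n) (p : PauliString n) : (g.conj p).op = g.op * p.op * g.op⁻¹ := by
  rw [eq_mul_inv_iff_mul_eq]
  cases g with
  | H i => exact (onWire_mul_op i _ p (hadamard_mul_letterOp _ _)).symm
  | Z i => simpa [conj, op] using (onWire_mul_op i _ p (pauliZ_mul_letterOp _ _)).symm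
  | CZ i h => exact (controlledZ_mul_op _ _ p).symm

/-- The automorphism of the group of Pauli strings induced by a gate. -/
noncomputable def Gate.act (g : Gate n) : MulAut (PauliString n) :=
  MulEquiv.ofBijective
    (MonoidHom.mk' g.conj fun p q => op_injective <| by
      simp only [g.op_conj, op_mul]
      group)
    (Finite.injective_iff_bijective.1 fun p q h => op_injective <| by
      simpa [g.op_conj] using congr_arg PauliString.op (show g.conj p = g.conj q from h))

theorem Gate.act_apply (g : Gate n) (p : PauliString n) : g.act p = g.conj p := rfl

/-- The automorphism of the group of Pauli strings induced by a circuit. -/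
noncomputable def Circuit.act : Circuit n → MulAut (PauliString n)
  | [] => 1
  | g :: w => Circuit.act w * g.act

theorem Circuit.act_append (w w' : Circuit n) : Circuit.act (w ++ w') = w'.act * w.act := by
  induction w with
  | nil => rfl
  | cons g w ih => simp only [List.cons_append, act, ih, mul_assoc]

theorem Circuit.op_act (w : Circuit n) (p : PauliString n) :
    (w.act p).op = w.op * p.op * w.op⁻¹ := by
  induction w generalizing p with
  | nil => simp [act, op]
  | cons g w ih =>
    simp only [act, MulAut.mul_apply, ih, g.act_apply, g.op_conj, op]
    group

end Gates

section Windows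

variable {m n i : ℕ}

/-- The `j`-th wire of the block of `m` wires that starts at wire `i`. -/
def wire (h : i + m ≤ n) (j : Fin m) : Fin n := (j.natAdd i).castLE h

theorem wire_injective (h : i + m ≤ n) : Function.Injective (wire h) :=
  (Fin.castLE_injective h).comp (Fin.natAdd_injective m i)

theorem coe_wire (h : i + m ≤ n) (j : Fin m) : (wire h j : ℕ) = i + j := rfl

theorem ne_wire {h : i + m ≤ n} {j : Fin n} (hj : j < i ∨ i + m ≤ j) (k : Fin m) :
    j ≠ wire h k := by
  rw [Ne, Fin.ext_iff, coe_wire]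
  omega

/-- A gate on `m` wires, placed on the block of wires that starts at wire `i`. -/
def Gate.shift (h : i + m ≤ n) : Gate m → Gate n
  | .H j => .H (wire h j)
  | .Z j => .Z (wire h j)
  | .CZ k hk => .CZ (i + k) (by omega)

/-- The part of a Pauli string on the block of `m` wires that starts at wire `i`, with the sign of
the whole string. -/
def PauliString.window (h : i + m ≤ n) (p : PauliString n) : PauliString m :=
  ⟨p.sign, p.x ∘ wire h, p.z ∘ wire h⟩

/-- The exponents of `X` and `Z` on wire `j`. -/
def PauliString.letter (p : PauliString n) (j : Fin n) : Fin 2 × Fin 2 := (p.x j, p.z j)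

theorem PauliString.ext_letter {p q : PauliString n} (sign : p.sign = q.sign)
    (letter : ∀ j, p.letter j = q.letter j) : p = q :=
  PauliString.ext sign (funext fun j => congr_arg Prod.fst (letter j))
    (funext fun j => congr_arg Prod.snd (letter j))

theorem PauliString.letter_window (h : i + m ≤ n) (p : PauliString n) (j : Fin m) :
    (p.window h).letter j = p.letter (wire h j) := rfl

theorem PauliString.ext_window (h : i + m ≤ n) {p q : PauliString n}
    (window : p.window h = q.window h)
    (letter : ∀ j : Fin n, j < i ∨ i + m ≤ j → p.letter j = q.letter j) : p = q := by
  refine ext_letter (congr_arg (·.sign) window :) fun j => ?_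
  by_cases hj : j < i ∨ i + m ≤ j
  · exact letter j hj
  · have : j = wire h ⟨j - i, by omega⟩ := Fin.ext (by rw [coe_wire]; dsimp only; omega)
    rw [this, ← letter_window, window, letter_window]

theorem PauliString.window_Z (h : i + m ≤ n) (j : Fin m) : (Z (wire h j)).window h = Z j := by
  ext : 1
  · rfl
  · rfl
  · ext k : 1
    simp [window, Z, Pi.single_apply, (wire_injective h).eq_iff]

theorem PauliString.letter_Z_of_ne {i j : Fin n} (h : i ≠ j) : (Z j).letter i = 0 := by
  simp [letter, Z, h]

theorem Gate.window_shift_act (h : i + m ≤ n) (g : Gate m) (p : PauliString n) :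
    ((g.shift h).act p).window h = g.act (p.window h) := by
  cases g with
  | H j =>
    simp only [shift, act_apply, conj, window]
    ext : 1
    · rfl
    · exact Function.update_comp_eq_of_injective _ (wire_injective h) _ _
    · exact Function.update_comp_eq_of_injective _ (wire_injective h) _ _
  | Z j => rfl
  | CZ k hk =>
    have top : (⟨i + k, by omega⟩ : Fin n) = wire h ⟨k, by omega⟩ := rfl
    have bot : (⟨i + k + 1, by omega⟩ : Fin n) = wire h ⟨k + 1, hk⟩ := rfl
    simp only [shift, act_apply, conj, window, top, bot]
    ext : 1
    · rfl
    · rfl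
    · ext j : 1
      simp [Pi.single_apply, (wire_injective h).eq_iff]

theorem Gate.letter_shift_act (h : i + m ≤ n) (g : Gate m) (p : PauliString n) {j : Fin n}
    (hj : j < i ∨ i + m ≤ j) : ((g.shift h).act p).letter j = p.letter j := by
  cases g with
  | H k => simp [shift, act_apply, conj, letter, ne_wire hj k]
  | Z k => rfl
  | CZ k hk =>
    have top : j ≠ ⟨i + k, by omega⟩ := ne_wire (h := h) hj ⟨k, by omega⟩
    have bot : j ≠ ⟨i + k + 1, by omega⟩ := ne_wire (h := h) hj ⟨k + 1, hk⟩
    simp [shift, act_apply, conj, letter, top, bot]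

theorem Circuit.window_shift_act (h : i + m ≤ n) (w : Circuit m) (p : PauliString n) :
    (Circuit.act (w.map (Gate.shift h)) p).window h = w.act (p.window h) := by
  induction w generalizing p with
  | nil => rfl
  | cons g w ih => simp only [List.map_cons, act, MulAut.mul_apply, ih, g.window_shift_act]

theorem Circuit.letter_shift_act (h : i + m ≤ n) (w : Circuit m) (p : PauliString n) {j : Fin n}
    (hj : j < i ∨ i + m ≤ j) :
    (Circuit.act (w.map (Gate.shift h)) p).letter j = p.letter j := by
  induction w generalizing p with
  | nil => rfl
  | cons g w ih => simp only [List.map_cons, act, MulAut.mul_apply, ih, g.letter_shift_act h p hj]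

end Windows

/-- The letter that stands on a wire of the given type: `Z` for single, `X * Z` for double. -/
def WireType.letter : WireType → Fin 2 × Fin 2
  | single => (0, 1)
  | double => (1, 1)

/-- The letter that an `A` gate turns into the letter of its output type. -/
def GateA.source {t : WireType} : GateA t → Fin 2 × Fin 2
  | .A1 => (0, 1)
  | .A2 => (1, 0)
  | .A3 => (1, 1)

/-- The letter on the upper wire that a `B` gate turns into the letter of its output type,
provided that the lower wire carries the letter of its input type; it then clears the lower wire. -/
def GateB.source {t u : WireType} : GateB t u → Fin 2 × Fin 2
  | .B1 | .B5 => (0, 0)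
  | .B2 | .B6 => (1, 0)
  | .B3 | .B7 => (0, 1)
  | .B4 | .B8 => (1, 1)

/-- The letter on the lower wire that tells a `D` gate apart: this gate, and no other, clears the
upper wire and creates an `X` on the lower one if the upper wire carries an `X`. -/
def GateD.source : GateD → Fin 2 × Fin 2
  | .D1 => (0, 0)
  | .D2 => (1, 0)
  | .D3 => (0, 1)
  | .D4 => (1, 1)

theorem GateB.circuit_eq_map_shift {n i : ℕ} {t u : WireType} (h : i + 2 ≤ n) (b : GateB t u) :
    b.circuit i h = (b.circuit 0 one_lt_two).map (Gate.shift h) := by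
  cases b <;> rfl

theorem GateD.circuit_eq_map_shift {n i : ℕ} (h : i + 2 ≤ n) (d : GateD) :
    d.circuit i h = (d.circuit 0 one_lt_two).map (Gate.shift h) := by
  cases d <;> rfl

theorem GateA.circuit_eq_map_shift {n i : ℕ} {t : WireType} (h : i + 1 ≤ n) (a : GateA t) :
    a.circuit ⟨i, h⟩ = (a.circuit 0).map (Gate.shift h) := by
  cases a <;> rfl

theorem GateA.letter_act {t : WireType} (a : GateA t) : ∀ p : PauliString 1,
    (Circuit.act (a.circuit 0) p).letter 0 = t.letter ↔ p.letter 0 = a.source := by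
  cases a <;> decide

theorem GateB.letter_act {t u : WireType} (b : GateB t u) : ∀ p : PauliString 2,
    ((b.circuit 0 one_lt_two).act p).letter 0 = u.letter ∧
      ((b.circuit 0 one_lt_two).act p).letter 1 = 0 ↔
    p.letter 0 = b.source ∧ p.letter 1 = t.letter := by
  cases b <;> decide

theorem GateD.letter_act (d : GateD) : ∀ p : PauliString 2,
    ((d.circuit 0 one_lt_two).act p).letter 0 = 0 ∧
      ((d.circuit 0 one_lt_two).act p).x 1 = 1 ↔
    p.x 0 = 1 ∧ p.letter 1 = d.source := by
  cases d <;> decide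

theorem GateD.act_Z (d : GateD) : (d.circuit 0 one_lt_two).act (Z 0) = Z 1 := by
  cases d <;> exact ext_letter (by decide) (by decide)

theorem GateA.source_ne_zero {t : WireType} (a : GateA t) : a.source ≠ 0 := by
  cases a <;> decide

theorem GateA.source_injective :
    Function.Injective fun a : Σ t, GateA t => a.2.source := by
  rintro ⟨_, a⟩ ⟨_, a'⟩ h
  cases a <;> cases a' <;> first | rfl | simp [source] at h

theorem GateA.exists_source_eq : ∀ x : Fin 2 × Fin 2, x ≠ 0 → ∃ t, ∃ a : GateA t, a.source = x
  | (0, 0), h => absurd rfl h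
  | (0, 1), _ => ⟨_, .A1, rfl⟩
  | (1, 0), _ => ⟨_, .A2, rfl⟩
  | (1, 1), _ => ⟨_, .A3, rfl⟩

theorem GateB.source_bijective (t : WireType) :
    Function.Bijective fun b : Σ u, GateB t u => b.2.source := by
  constructor
  · rintro ⟨_, b⟩ ⟨_, b'⟩ h
    cases b <;> cases b' <;> first | rfl | simp [source] at h
  · cases t
    · exact fun
        | (0, 0) => ⟨⟨_, .B1⟩, rfl⟩
        | (1, 0) => ⟨⟨_, .B2⟩, rfl⟩
        | (0, 1) => ⟨⟨_, .B3⟩, rfl⟩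
        | (1, 1) => ⟨⟨_, .B4⟩, rfl⟩
    · exact fun
        | (0, 0) => ⟨⟨_, .B5⟩, rfl⟩
        | (1, 0) => ⟨⟨_, .B6⟩, rfl⟩
        | (0, 1) => ⟨⟨_, .B7⟩, rfl⟩
        | (1, 1) => ⟨⟨_, .B8⟩, rfl⟩

theorem GateD.source_bijective : Function.Bijective source := by
  constructor
  · intro d d' h
    cases d <;> cases d' <;> first | rfl | simp [source] at h
  · exact fun
      | (0, 0) => ⟨.D1, rfl⟩
      | (1, 0) => ⟨.D2, rfl⟩
      | (0, 1) => ⟨.D3, rfl⟩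
      | (1, 1) => ⟨.D4, rfl⟩

section ZCircuits

variable {n : ℕ}

/-- Wire `k` is the last wire on which `p` is nontrivial, and it carries the letter of type `t`. -/
def EndsAt (k : Fin n) (t : WireType) (p : PauliString n) : Prop :=
  p.letter k = t.letter ∧ ∀ j, k < j → p.letter j = 0

theorem GateA.endsAt_act_iff {t : WireType} (a : GateA t) (k : Fin n) (p : PauliString n) :
    EndsAt k t (Circuit.act (a.circuit k) p) ↔
      p.letter k = a.source ∧ ∀ j, k < j → p.letter j = 0 := by
  obtain ⟨k, h⟩ := k
  have on := a.letter_act (p.window h)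
  rw [← Circuit.window_shift_act] at on
  rw [EndsAt, a.circuit_eq_map_shift h]
  refine and_congr on (forall₂_congr fun j hj => ?_)
  rw [Circuit.letter_shift_act h _ _ (Or.inr hj)]

theorem GateB.endsAt_act_iff {t u : WireType} (b : GateB t u) {k : ℕ} (h : k + 2 ≤ n)
    (p : PauliString n) :
    EndsAt ⟨k, by omega⟩ u ((b.circuit k h).act p) ↔
      p.letter ⟨k, by omega⟩ = b.source ∧ EndsAt ⟨k + 1, h⟩ t p := by
  have on := b.letter_act (p.window h)
  rw [← Circuit.window_shift_act] at on
  have off (j : Fin n) (hj : k + 1 < j) :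
      (Circuit.act ((b.circuit 0 one_lt_two).map (Gate.shift h)) p).letter j = p.letter j :=
    Circuit.letter_shift_act h _ _ (Or.inr hj)
  have split (q : PauliString n) : (∀ j, ⟨k, by omega⟩ < j → q.letter j = 0) ↔
      q.letter ⟨k + 1, h⟩ = 0 ∧ ∀ j : Fin n, k + 1 < j → q.letter j = 0 := by
    refine ⟨fun hq => ⟨hq _ (Nat.lt_succ_self k), fun j hj => hq j (Nat.lt_of_succ_lt hj)⟩,
      fun hq j hj => ?_⟩
    rcases (show (⟨k + 1, h⟩ : Fin n) ≤ j from hj).eq_or_lt with rfl | hj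
    · exact hq.1
    · exact hq.2 j hj
  rw [EndsAt, EndsAt, split, b.circuit_eq_map_shift h, ← and_assoc, ← and_assoc]
  exact and_congr on (forall₂_congr fun j hj => by rw [off j hj])

theorem PauliString.mul_self_act {p : PauliString n} (hp : p * p = 1) (w : Circuit n) :
    w.act p * w.act p = 1 := by
  rw [← map_mul, hp, map_one]

theorem PauliString.eq_single {p : PauliString n} {i : Fin n} (h : ∀ j ≠ i, p.letter j = 0) :
    p = ⟨p.sign, Pi.single i (p.x i), Pi.single i (p.z i)⟩ := by
  refine ext_letter rfl fun j => ?_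
  rcases eq_or_ne j i with rfl | hj
  · simp [PauliString.letter]
  · simpa [PauliString.letter, Prod.ext_iff, hj] using h j hj

theorem PauliString.z_mul_x_eq_zero_of_mul_self {p : PauliString n} (hp : p * p = 1) {i : Fin n}
    (h : ∀ j ≠ i, p.letter j = 0) : p.z i * p.x i = 0 := by
  have square_sign : p.z ⬝ᵥ p.x = 0 := by
    simpa [CharTwo.add_self_eq_zero] using congr_arg sign hp
  rw [eq_single h] at square_sign
  simpa using square_sign

theorem EndsAt.eq_mk {p : PauliString (n + 1)} {t : WireType} (hp : p * p = 1) (h : EndsAt 0 t p) :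
    t = single ∧ p = ⟨p.sign, 0, Pi.single 0 1⟩ := by
  obtain ⟨top, rest⟩ := h
  replace rest (j : Fin (n + 1)) (hj : j ≠ 0) := rest j (Fin.pos_of_ne_zero hj)
  have square := z_mul_x_eq_zero_of_mul_self hp rest
  have form := eq_single rest
  obtain ⟨hx, hz⟩ : p.x 0 = t.letter.1 ∧ p.z 0 = t.letter.2 := Prod.ext_iff.1 top
  cases t with
  | single => exact ⟨rfl, by simpa [hx, hz, WireType.letter] using form⟩
  | double => exact absurd square (by rw [hx, hz]; decide)

theorem endsAt_Z : EndsAt 0 single (Z (0 : Fin (n + 1))) :=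
  ⟨by simp [PauliString.letter, WireType.letter, Z], fun _ hj => letter_Z_of_ne hj.ne'⟩

theorem BLadder.act_cons {k : ℕ} {t u : WireType} (b : GateB t u) (l : BLadder k u)
    (h : k + 1 < n) (p : PauliString n) :
    ((BLadder.cons b l).circuit n h).act p =
      (l.circuit n (by omega)).act ((b.circuit k h).act p) := by
  rw [circuit, Circuit.act_append, MulAut.mul_apply]

theorem BLadder.endsAt_of_act {k : ℕ} {t : WireType} (l : BLadder k t) (h : k < n + 1)
    (p : PauliString (n + 1)) (hp : EndsAt 0 single ((l.circuit (n + 1) h).act p)) :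
    EndsAt ⟨k, h⟩ t p := by
  induction l generalizing p with
  | nil => exact hp
  | cons b l ih =>
    rw [act_cons] at hp
    exact ((b.endsAt_act_iff h p).1 (ih _ _ hp)).2

theorem existsUnique_bLadder {k : ℕ} (h : k < n + 1) {t : WireType} {p : PauliString (n + 1)}
    (hp : p * p = 1) (ends : EndsAt ⟨k, h⟩ t p) :
    ∃! l : BLadder k t, EndsAt 0 single ((l.circuit (n + 1) h).act p) := by
  induction k generalizing t p with
  | zero =>
    obtain rfl := (ends.eq_mk hp).1
    exact ⟨.nil, ends, fun | .nil, _ => rfl⟩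
  | succ k ih =>
    obtain ⟨⟨u, b⟩, hb⟩ := (GateB.source_bijective t).2 (p.letter ⟨k, by omega⟩)
    obtain ⟨l, hl, unique⟩ := ih (by omega) (mul_self_act hp (b.circuit k h))
      ((b.endsAt_act_iff h p).2 ⟨hb.symm, ends⟩)
    refine ⟨.cons b l, by simpa only [BLadder.act_cons] using hl, ?_⟩
    rintro (_ | ⟨b', l'⟩) hl'
    rw [BLadder.act_cons] at hl'
    have hb' := ((b'.endsAt_act_iff h p).1 (l'.endsAt_of_act _ _ hl')).1
    obtain ⟨rfl, hbb'⟩ := Sigma.mk.inj_iff.1 ((GateB.source_bijective t).1 (hb.trans hb'))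
    obtain rfl := eq_of_heq hbb'
    rw [unique l' hl']

/-- Whether the gate is nonempty, as the bit that multiplies its effect on signs. -/
def GateC.bit : GateC → Fin 2
  | .C1 => 0
  | .C2 => 1

theorem GateC.existsUnique_bit_eq (s : Fin 2) : ∃! c : GateC, c.bit = s :=
  match s with
  | 0 => ⟨.C1, rfl, fun | .C1, _ => rfl⟩
  | 1 => ⟨.C2, rfl, fun | .C2, _ => rfl⟩

theorem GateC.act_apply (c : GateC) (i : Fin n) (p : PauliString n) :
    Circuit.act (c.circuit i) p = ⟨p.sign + c.bit * p.z i, p.x, p.z⟩ := by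
  cases c
  · simp [circuit, Circuit.act, bit]
  · simp only [circuit, Circuit.act, one_mul, MulAut.mul_apply, Gate.act_apply, Gate.conj, bit,
      Function.update_self, Function.update_idem, Function.update_eq_self, mk.injEq, and_self,
      and_true]
    linear_combination p.x i * p.z i * (CharTwo.two_eq_zero : (2 : Fin 2) = 0)

theorem GateC.endsAt_act_iff (c : GateC) (i : Fin n) {k : Fin n} {t : WireType}
    {p : PauliString n} : EndsAt k t (Circuit.act (c.circuit i) p) ↔ EndsAt k t p := by
  rw [act_apply]
  rfl

theorem existsUnique_gateC {p : PauliString (n + 1)} (hp : p * p = 1) (ends : EndsAt 0 single p) :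
    ∃! c : GateC, Circuit.act (c.circuit 0) p = Z 0 := by
  obtain ⟨-, form⟩ := ends.eq_mk hp
  have iff (c : GateC) : Circuit.act (c.circuit 0) p = Z 0 ↔ c.bit = p.sign := by
    rw [form]
    simpa [GateC.act_apply, Z, CharTwo.add_eq_zero] using eq_comm
  simpa only [iff] using GateC.existsUnique_bit_eq p.sign

theorem ZCircuit.act_apply (L : ZCircuit n) (p : PauliString (n + 1)) :
    L.circuit.act p = Circuit.act (L.c.circuit 0)
      ((L.ladder.circuit (n + 1) L.m.isLt).act (Circuit.act (L.a.circuit L.m) p)) := by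
  simp only [circuit, Circuit.act_append, MulAut.mul_apply]

theorem ZCircuit.endsAt_of_act_eq {L : ZCircuit n} {p : PauliString (n + 1)}
    (h : L.circuit.act p = Z 0) : EndsAt 0 single
      ((L.ladder.circuit (n + 1) L.m.isLt).act (Circuit.act (L.a.circuit L.m) p)) := by
  rw [← L.c.endsAt_act_iff 0, ← act_apply, h]
  exact endsAt_Z

theorem existsUnique_zCircuit {p : PauliString (n + 1)} (hp : p * p = 1)
    (nontrivial : ∃ j, p.letter j ≠ 0) : ∃! L : ZCircuit n, L.circuit.act p = Z 0 := by
  obtain ⟨m, hm, last⟩ := wellFounded_gt.has_min {j | p.letter j ≠ 0} nontrivial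
  replace last (j) (hj : m < j) : p.letter j = 0 := not_not.1 fun h => last j h hj
  obtain ⟨t, a, ha⟩ := GateA.exists_source_eq _ hm
  have ends := (a.endsAt_act_iff m p).2 ⟨ha.symm, last⟩
  obtain ⟨l, hl, unique_l⟩ := existsUnique_bLadder m.isLt (mul_self_act hp _) ends
  obtain ⟨c, hc, unique_c⟩ := existsUnique_gateC (mul_self_act (mul_self_act hp _) _) hl
  refine ⟨⟨m, t, a, l, c⟩, by simpa only [ZCircuit.act_apply] using hc, ?_⟩
  rintro ⟨m', t', a', l', c'⟩ h
  have hl' := ZCircuit.endsAt_of_act_eq h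
  obtain ⟨ha', last'⟩ := (a'.endsAt_act_iff m' p).1 (l'.endsAt_of_act _ _ hl')
  obtain rfl : m' = m :=
    le_antisymm (not_lt.1 fun h => a'.source_ne_zero (ha'.symm.trans (last _ h)))
      (not_lt.1 fun h => hm (last' _ h))
  obtain ⟨rfl, haa'⟩ := Sigma.mk.inj_iff.1
    (GateA.source_injective (a₁ := ⟨t, a⟩) (a₂ := ⟨t', a'⟩) (ha.trans ha'))
  obtain rfl := eq_of_heq haa'
  obtain rfl := unique_l l' hl'
  rw [ZCircuit.act_apply] at h
  rw [unique_c c' h]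

end ZCircuits

section XCircuits

variable {n : ℕ}

/-- Wire `k` is the first wire on which `p` is nontrivial, and `p` contains an `X` there. -/
def StartsAt (k : Fin n) (p : PauliString n) : Prop :=
  (∀ j < k, p.letter j = 0) ∧ p.x k = 1

theorem GateD.startsAt_act_iff (d : GateD) {k : ℕ} (h : k + 2 ≤ n) (p : PauliString n) :
    StartsAt ⟨k + 1, h⟩ ((d.circuit k h).act p) ↔
      StartsAt ⟨k, by omega⟩ p ∧ p.letter ⟨k + 1, h⟩ = d.source := by
  have on := d.letter_act (p.window h)
  rw [← Circuit.window_shift_act] at on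
  have off (j : Fin n) (hj : j < k) :
      (Circuit.act ((d.circuit 0 one_lt_two).map (Gate.shift h)) p).letter j = p.letter j :=
    Circuit.letter_shift_act h _ _ (Or.inl hj)
  have split (q : PauliString n) : (∀ j < ⟨k + 1, h⟩, q.letter j = 0) ↔
      (∀ j : Fin n, j < k → q.letter j = 0) ∧ q.letter ⟨k, by omega⟩ = 0 := by
    refine ⟨fun hq => ⟨fun j hj => hq j (Nat.lt_succ_of_lt hj), hq _ (Nat.lt_succ_self k)⟩,
      fun hq j hj => ?_⟩
    rcases (show j ≤ (⟨k, by omega⟩ : Fin n) from Nat.le_of_lt_succ hj).eq_or_lt with hjk | hj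
    · rw [hjk, hq.2]
    · exact hq.1 j hj
  rw [StartsAt, StartsAt, split, d.circuit_eq_map_shift h, and_assoc, and_assoc]
  exact and_congr (forall₂_congr fun j hj => by rw [off j hj]) on

theorem GateD.circuit_act_Z (d : GateD) {k : ℕ} (h : k + 2 ≤ n) :
    (d.circuit k h).act (Z ⟨k, by omega⟩) = Z ⟨k + 1, h⟩ := by
  rw [d.circuit_eq_map_shift h]
  refine ext_window h ?_ fun j hj => ?_
  · rw [Circuit.window_shift_act]
    exact (congr_arg _ (window_Z h 0)).trans (d.act_Z.trans (window_Z h 1).symm)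
  · rw [Circuit.letter_shift_act h _ _ hj]
    exact (letter_Z_of_ne (ne_wire (h := h) hj 0)).trans
      (letter_Z_of_ne (ne_wire (h := h) hj 1)).symm

/-- The first `k` gates of the ladder of an `X`-circuit. -/
def dLadder (d : Fin n → GateD) (k : ℕ) (hk : k ≤ n) : Circuit (n + 1) :=
  (List.finRange k).flatMap fun i : Fin k => (d (i.castLE hk)).circuit i.val (by omega)

theorem dLadder_succ_act (d : Fin n → GateD) {k : ℕ} (hk : k < n) (p : PauliString (n + 1)) :
    (dLadder d (k + 1) hk).act p =
      ((d ⟨k, hk⟩).circuit k (by omega)).act ((dLadder d k hk.le).act p) := by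
  rw [← MulAut.mul_apply, ← Circuit.act_append]
  congr 2
  simp only [dLadder, List.finRange_succ_last, List.flatMap_append, List.flatMap_map,
    List.flatMap_singleton]
  rfl

theorem dLadder_act_Z (d : Fin n → GateD) {k : ℕ} (hk : k ≤ n) :
    (dLadder d k hk).act (Z 0) = Z ⟨k, by omega⟩ := by
  induction k with
  | zero => rfl
  | succ k ih => rw [dLadder_succ_act, ih, GateD.circuit_act_Z]

theorem letter_dLadder_act (d : Fin n → GateD) {k : ℕ} (hk : k ≤ n) (p : PauliString (n + 1))
    {j : Fin (n + 1)} (hj : k < j) : ((dLadder d k hk).act p).letter j = p.letter j := by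
  induction k with
  | zero => rfl
  | succ k ih =>
    rw [dLadder_succ_act, GateD.circuit_eq_map_shift, Circuit.letter_shift_act _ _ _ (Or.inr hj),
      ih (by omega) (by omega)]

theorem startsAt_dLadder_act_iff (d : Fin n → GateD) {k : ℕ} (hk : k ≤ n)
    (p : PauliString (n + 1)) : StartsAt ⟨k, by omega⟩ ((dLadder d k hk).act p) ↔
      p.x 0 = 1 ∧ ∀ i : Fin n, i < k → p.letter i.succ = (d i).source := by
  induction k with
  | zero => exact ⟨fun h => ⟨h.2, fun _ hi => absurd hi (Nat.not_lt_zero _)⟩,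
      fun h => ⟨fun _ hj => absurd hj (Nat.not_lt_zero _), h.1⟩⟩
  | succ k ih =>
    rw [dLadder_succ_act, GateD.startsAt_act_iff, ih (by omega),
      letter_dLadder_act d _ p (Nat.lt_succ_self k), and_assoc]
    refine and_congr_right fun _ => ⟨fun ⟨init, top⟩ i hi => ?_,
      fun h => ⟨fun i hi => h i (Nat.lt_succ_of_lt hi), h ⟨k, hk⟩ (Nat.lt_succ_self k)⟩⟩
    rcases (Nat.le_of_lt_succ hi).eq_or_lt with hik | hik
    · rwa [show i = ⟨k, hk⟩ from Fin.ext hik]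
    · exact init i hik

/-- Whether the gate is nonempty, as the bit that multiplies its effect on signs. -/
def GateE.bit : GateE → Fin 2
  | .E1 => 0
  | .E2 => 1

theorem GateE.existsUnique_bit_eq (s : Fin 2) : ∃! e : GateE, e.bit = s :=
  match s with
  | 0 => ⟨.E1, rfl, fun | .E1, _ => rfl⟩
  | 1 => ⟨.E2, rfl, fun | .E2, _ => rfl⟩

theorem GateE.act_apply (e : GateE) (i : Fin n) (p : PauliString n) :
    Circuit.act (e.circuit i) p = ⟨p.sign + e.bit * p.x i, p.x, p.z⟩ := by
  cases e <;> simp [circuit, Circuit.act, Gate.act_apply, Gate.conj, bit]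

theorem GateE.startsAt_act_iff (e : GateE) (i : Fin n) {k : Fin n}
    {p : PauliString n} : StartsAt k (Circuit.act (e.circuit i) p) ↔ StartsAt k p := by
  rw [act_apply]
  rfl

theorem startsAt_X : StartsAt (Fin.last n) (X (Fin.last n)) :=
  ⟨fun j hj => by simp [PauliString.letter, X, hj.ne], by simp [X]⟩

theorem existsUnique_gateE {p : PauliString (n + 1)} (hp : p * p = 1)
    (starts : StartsAt (Fin.last n) p) :
    ∃! e : GateE, Circuit.act (e.circuit (Fin.last n)) p = X (Fin.last n) := by
  obtain ⟨init, hx⟩ := starts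
  replace init (j : Fin (n + 1)) (hj : j ≠ Fin.last n) := init j (Fin.lt_last_iff_ne_last.2 hj)
  have hz : p.z (Fin.last n) = 0 := by
    simpa [hx] using z_mul_x_eq_zero_of_mul_self hp init
  have iff (e : GateE) :
      Circuit.act (e.circuit (Fin.last n)) p = X (Fin.last n) ↔ e.bit = p.sign := by
    rw [eq_single init, hx, hz]
    simpa [GateE.act_apply, X, CharTwo.add_eq_zero] using eq_comm
  simpa only [iff] using GateE.existsUnique_bit_eq p.sign

theorem XCircuit.act_apply (M : XCircuit n) (p : PauliString (n + 1)) :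
    M.circuit.act p =
      Circuit.act (M.e.circuit (Fin.last n)) ((dLadder M.d n le_rfl).act p) := by
  rw [← MulAut.mul_apply, ← Circuit.act_append]
  rfl

theorem XCircuit.act_Z (M : XCircuit n) : M.circuit.act (Z 0) = Z (Fin.last n) := by
  rw [act_apply, dLadder_act_Z, GateE.act_apply]
  simp [Z, Fin.last]

theorem existsUnique_xCircuit {p : PauliString (n + 1)} (hp : p * p = 1) (hx : p.x 0 = 1) :
    ∃! M : XCircuit n, M.circuit.act p = X (Fin.last n) := by
  choose d hd using fun i : Fin n => GateD.source_bijective.2 (p.letter i.succ)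
  have starts := (startsAt_dLadder_act_iff d le_rfl p).2 ⟨hx, fun i _ => (hd i).symm⟩
  obtain ⟨e, he, unique⟩ := existsUnique_gateE (mul_self_act hp _) starts
  refine ⟨⟨d, e⟩, by simpa only [XCircuit.act_apply] using he, ?_⟩
  rintro ⟨d', e'⟩ h
  rw [XCircuit.act_apply] at h
  have starts' := (e'.startsAt_act_iff _).1 (h ▸ startsAt_X)
  obtain rfl : d' = d := funext fun i => GateD.source_bijective.1
    ((((startsAt_dLadder_act_iff d' le_rfl p).1 starts').2 i i.2).symm.trans (hd i).symm)
  rw [unique e' h]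

end XCircuits

section LastWire

variable {n : ℕ}

namespace PauliString

theorem commute_iff (p q : PauliString n) : Commute p q ↔ p.z ⬝ᵥ q.x = q.z ⬝ᵥ p.x := by
  simp [commute_iff_eq, PauliString.ext_iff, add_comm q.sign, add_comm q.x, add_comm q.z]

theorem commute_Z_iff (p : PauliString n) (i : Fin n) : Commute p (Z i) ↔ p.x i = 0 := by
  simp [commute_iff, Z, eq_comm]

theorem commute_X_iff (p : PauliString n) (i : Fin n) : Commute p (X i) ↔ p.z i = 0 := by
  simp [commute_iff, X]

theorem exists_letter_ne_zero_of_not_commute {p q : PauliString n} (h : ¬Commute p q) :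
    ∃ j, p.letter j ≠ 0 := by
  contrapose! h
  obtain ⟨hx, hz⟩ : p.x = 0 ∧ p.z = 0 :=
    ⟨funext fun j => congr_arg Prod.fst (h j), funext fun j => congr_arg Prod.snd (h j)⟩
  simp [commute_iff, hx, hz]

theorem X_mul_self (i : Fin n) : X i * X i = 1 :=
  PauliString.ext (by simp [X]) (bits_add_self _) (bits_add_self _)

theorem Z_mul_self (i : Fin n) : Z i * Z i = 1 :=
  PauliString.ext (by simp [Z]) (bits_add_self _) (bits_add_self _)

theorem not_commute_Z_X (i : Fin n) : ¬Commute (Z i) (X i) := by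
  simp [commute_X_iff, Z]

/-- The part of a Pauli string on all wires but the last, with the sign of the whole string. -/
def init (p : PauliString (n + 1)) : PauliString n :=
  p.window (show 0 + n ≤ n + 1 by omega)

/-- The embedding `p ↦ p ⊗ I` of Pauli strings that adds a wire at the bottom. -/
def extend : PauliString n →* PauliString (n + 1) :=
  MonoidHom.mk' (fun p => ⟨p.sign, Fin.snoc (α := fun _ => Fin 2) p.x 0,
    Fin.snoc (α := fun _ => Fin 2) p.z 0⟩) fun p q => by
      refine PauliString.ext ?_ (funext (Fin.lastCases ?_ ?_)) (funext (Fin.lastCases ?_ ?_)) <;>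
        simp [dotProduct, Fin.sum_univ_castSucc]

theorem wire_zero (h : 0 + n ≤ n + 1) : wire h = Fin.castSucc :=
  funext fun _ => Fin.ext (Nat.zero_add _)

theorem init_extend (p : PauliString n) : (extend p).init = p := by
  ext : 1
  · rfl
  · ext1 i
    simp [init, window, extend, wire_zero]
  · ext1 i
    simp [init, window, extend, wire_zero]

theorem extend_injective : Function.Injective (extend : PauliString n → PauliString (n + 1)) :=
  Function.LeftInverse.injective init_extend

theorem letter_extend_last (p : PauliString n) : (extend p).letter (Fin.last n) = 0 := by
  simp [letter, extend]

theorem ext_init {p q : PauliString (n + 1)} (init : p.init = q.init)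
    (last : p.letter (Fin.last n) = q.letter (Fin.last n)) : p = q := by
  refine ext_window _ init fun j hj => ?_
  rwa [show j = Fin.last n from Fin.ext (by rw [Fin.val_last]; omega)]

theorem extend_init {p : PauliString (n + 1)} (h : p.letter (Fin.last n) = 0) :
    extend p.init = p :=
  ext_init (init_extend _) ((letter_extend_last _).trans h.symm)

theorem X_pow (i : Fin n) (a : Fin 2) : X i ^ (a : ℕ) = ⟨0, Pi.single i a, 0⟩ := by
  fin_cases a
  · exact PauliString.ext rfl (Pi.single_zero i).symm rfl
  · exact pow_one _

theorem Z_pow (i : Fin n) (b : Fin 2) : Z i ^ (b : ℕ) = ⟨0, 0, Pi.single i b⟩ := by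
  fin_cases b
  · exact PauliString.ext rfl rfl (Pi.single_zero i).symm
  · exact pow_one _

theorem eq_extend_init_mul (p : PauliString (n + 1)) :
    p = extend p.init * X (Fin.last n) ^ (p.x (Fin.last n) : ℕ) *
      Z (Fin.last n) ^ (p.z (Fin.last n) : ℕ) := by
  rw [X_pow, Z_pow]
  refine PauliString.ext ?_ (funext (Fin.lastCases ?_ ?_)) (funext (Fin.lastCases ?_ ?_)) <;>
    simp [init, window, extend, wire_zero]

theorem mulAut_ext {f g : MulAut (PauliString (n + 1))} (extend : ∀ p, f (extend p) = g (extend p))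
    (X_last : f (X (Fin.last n)) = g (X (Fin.last n)))
    (Z_last : f (Z (Fin.last n)) = g (Z (Fin.last n))) : f = g := by
  ext1 p
  rw [eq_extend_init_mul p]
  simp only [map_mul, map_pow, extend, X_last, Z_last]

variable {ψ : MulAut (PauliString (n + 1))}

theorem extend_init_apply (hX : ψ (X (Fin.last n)) = X (Fin.last n))
    (hZ : ψ (Z (Fin.last n)) = Z (Fin.last n)) (p : PauliString n) :
    extend (ψ (extend p)).init = ψ (extend p) := by
  refine extend_init (Prod.ext ((commute_Z_iff _ _).1 ?_) ((commute_X_iff _ _).1 ?_))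
  · rw [← hZ]
    exact ((commute_Z_iff _ _).2 (congr_arg Prod.fst (letter_extend_last p))).map ψ
  · rw [← hX]
    exact ((commute_X_iff _ _).2 (congr_arg Prod.snd (letter_extend_last p))).map ψ

/-- The restriction to the first `n` wires of an automorphism that fixes `X` and `Z` on the last
wire. -/
noncomputable def restrictAut (hX : ψ (X (Fin.last n)) = X (Fin.last n))
    (hZ : ψ (Z (Fin.last n)) = Z (Fin.last n)) : MulAut (PauliString n) :=
  MulEquiv.ofBijective
    (MonoidHom.mk' (fun p => (ψ (extend p)).init) fun p q => extend_injective <| by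
      rw [map_mul extend p q, map_mul ψ, map_mul extend]
      simp only [extend_init_apply hX hZ, ← map_mul])
    (Finite.injective_iff_bijective.1 fun p q h => extend_injective <| ψ.injective <| by
      rw [← extend_init_apply hX hZ, ← extend_init_apply hX hZ q]
      exact congr_arg extend h)

theorem extend_restrictAut (hX : ψ (X (Fin.last n)) = X (Fin.last n))
    (hZ : ψ (Z (Fin.last n)) = Z (Fin.last n)) (p : PauliString n) :
    extend (restrictAut hX hZ p) = ψ (extend p) :=
  extend_init_apply hX hZ p

end PauliString

theorem Gate.castSucc_eq_shift (h : 0 + n ≤ n + 1) :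
    (castSucc : Gate n → Gate (n + 1)) = shift h := by
  funext g
  cases g <;> simp [castSucc, shift, wire_zero]

theorem Circuit.castSucc_act_extend (w : Circuit n) (p : PauliString n) :
    Circuit.act (w.map Gate.castSucc) (extend p) = extend (w.act p) := by
  have h : 0 + n ≤ n + 1 := by omega
  rw [Gate.castSucc_eq_shift h]
  refine ext_init ?_ ?_
  · rw [init, window_shift_act, init_extend]
    exact congr_arg _ (init_extend p)
  · rw [letter_shift_act h _ _ (Or.inr (by simp)), letter_extend_last, letter_extend_last]

theorem Circuit.castSucc_act_of_init {p : PauliString (n + 1)} (hp : p.init = 1) (w : Circuit n) :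
    Circuit.act (w.map Gate.castSucc) p = p := by
  have h : 0 + n ≤ n + 1 := by omega
  rw [Gate.castSucc_eq_shift h]
  refine ext_init ?_ (letter_shift_act h _ _ (Or.inr (by simp)))
  rw [init, window_shift_act, ← init, hp, map_one]

theorem Circuit.castSucc_act_X_last (w : Circuit n) :
    Circuit.act (w.map Gate.castSucc) (X (Fin.last n)) = X (Fin.last n) :=
  castSucc_act_of_init (PauliString.ext rfl
    (funext fun i => by simp [init, window, wire_zero, X, Fin.castSucc_ne_last]) rfl) w

theorem Circuit.castSucc_act_Z_last (w : Circuit n) :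
    Circuit.act (w.map Gate.castSucc) (Z (Fin.last n)) = Z (Fin.last n) :=
  castSucc_act_of_init (PauliString.ext rfl rfl
    (funext fun i => by simp [init, window, wire_zero, Z, Fin.castSucc_ne_last])) w

theorem Circuit.castSucc_act_eq_iff {ψ : MulAut (PauliString (n + 1))}
    (hX : ψ (X (Fin.last n)) = X (Fin.last n)) (hZ : ψ (Z (Fin.last n)) = Z (Fin.last n))
    (w : Circuit n) : Circuit.act (w.map Gate.castSucc) = ψ ↔ w.act = restrictAut hX hZ := by
  constructor
  · rintro rfl
    ext1 p
    exact extend_injective (by rw [extend_restrictAut, castSucc_act_extend])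
  · intro h
    refine mulAut_ext (fun p => ?_) ?_ ?_
    · rw [castSucc_act_extend, h, extend_restrictAut]
    · rw [castSucc_act_X_last, hX]
    · rw [castSucc_act_Z_last, hZ]

/-- Every `X`-circuit moves `Z 0` to the last wire, so the `Z`-circuit depends on `a` alone. -/
theorem existsUnique_xCircuit_zCircuit {a b : PauliString (n + 1)} (ha : a * a = 1)
    (hb : b * b = 1) (hab : ¬Commute a b) : ∃! ML : XCircuit n × ZCircuit n,
      (ML.1.circuit.act * ML.2.circuit.act) b = X (Fin.last n) ∧
        (ML.1.circuit.act * ML.2.circuit.act) a = Z (Fin.last n) := by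
  obtain ⟨L, hL, unique_L⟩ :=
    existsUnique_zCircuit (n := n) ha (exists_letter_ne_zero_of_not_commute hab)
  have hx : (L.circuit.act b).x 0 = 1 := by
    refine Fin.eq_one_of_ne_zero _ fun h => hab ?_
    rw [← commute_Z_iff, ← hL] at h
    exact (h.of_map L.circuit.act.injective).symm
  obtain ⟨M, hM, unique_M⟩ := existsUnique_xCircuit (mul_self_act hb _) hx
  refine ⟨(M, L), ⟨hM, by rw [MulAut.mul_apply, hL, M.act_Z]⟩, ?_⟩
  rintro ⟨M', L'⟩ ⟨hX, hZ⟩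
  obtain rfl : L' = L := unique_L L' (M'.circuit.act.injective (hZ.trans M'.act_Z.symm))
  rw [unique_M M' hX]

theorem existsUnique_mul_inv_apply_last (φ : MulAut (PauliString (n + 1))) :
    ∃! ML : XCircuit n × ZCircuit n,
      (φ * (ML.1.circuit.act * ML.2.circuit.act)⁻¹) (X (Fin.last n)) = X (Fin.last n) ∧
        (φ * (ML.1.circuit.act * ML.2.circuit.act)⁻¹) (Z (Fin.last n)) = Z (Fin.last n) := by
  have fixed_iff (g : MulAut (PauliString (n + 1))) (p : PauliString (n + 1)) :
      (φ * g⁻¹) p = p ↔ g (φ⁻¹ p) = p := by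
    rw [MulAut.mul_apply, ← MulEquiv.eq_symm_apply, MulAut.inv_apply, MulEquiv.symm_apply_eq,
      eq_comm, MulAut.inv_apply]
  simp only [fixed_iff]
  refine existsUnique_xCircuit_zCircuit (by rw [← map_mul, Z_mul_self, map_one])
    (by rw [← map_mul, X_mul_self, map_one])
    fun h => not_commute_Z_X (Fin.last n) (h.of_map φ⁻¹.injective)

theorem NormalBody.act_step (C : NormalBody n) (M : XCircuit n) (L : ZCircuit n) :
    (step C M L).circuit.act =
      Circuit.act (C.circuit.map Gate.castSucc) * (M.circuit.act * L.circuit.act) := by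
  rw [circuit, Circuit.act_append, Circuit.act_append]

end LastWire

theorem PauliString.mulAut_zero_eq_one (φ : MulAut (PauliString 0)) : φ = 1 := by
  have card : ∀ s t : Fin 2, t ≠ 0 → s ≠ 0 → s = t := by decide
  have ext_sign {p q : PauliString 0} (h : p.sign = q.sign) : p = q :=
    PauliString.ext h (Subsingleton.elim _ _) (Subsingleton.elim _ _)
  ext1 p
  by_cases hp : p = 1
  · rw [hp, map_one, map_one]
  · exact ext_sign (card _ _ (fun h => hp (ext_sign h))
      fun h => hp ((map_eq_one_iff φ φ.injective).1 (ext_sign h)))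

theorem existsUnique_normalBody {n : ℕ} (φ : MulAut (PauliString n)) :
    ∃! C : NormalBody n, C.circuit.act = φ := by
  induction n with
  | zero => exact ⟨.nil, (mulAut_zero_eq_one φ).symm, fun | .nil, _ => rfl⟩
  | succ n ih =>
    obtain ⟨⟨M, L⟩, ⟨hX, hZ⟩, unique⟩ := existsUnique_mul_inv_apply_last φ
    obtain ⟨C, hC, unique_C⟩ := ih (restrictAut hX hZ)
    rw [← Circuit.castSucc_act_eq_iff, eq_mul_inv_iff_mul_eq, ← NormalBody.act_step] at hC
    refine ⟨.step C M L, hC, ?_⟩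
    rintro (_ | ⟨C', M', L'⟩) h
    rw [NormalBody.act_step, ← eq_mul_inv_iff_mul_eq] at h
    obtain ⟨rfl, rfl⟩ := Prod.ext_iff.1 <| unique (M', L')
      (by simp only [← h, Circuit.castSucc_act_X_last, Circuit.castSucc_act_Z_last, and_self])
    rw [unique_C C' ((Circuit.castSucc_act_eq_iff hX hZ _).1 h)]

theorem op_mem_pauliGroup {n : ℕ} (p : PauliString n) : p.op ∈ pauliGroup n :=
  (pauliEquiv n p).2

theorem neg_conj {G : Type*} [Group G] [HasDistribNeg G] (a b : G) :
    -a * b * (-a)⁻¹ = a * b * a⁻¹ := by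
  rw [mul_inv_eq_iff_eq_mul, mul_neg, inv_mul_cancel_right, neg_mul]

theorem mem_cliffordGroup_of_forall_op {n : ℕ} {U : Ortho n}
    (hU : ∀ p : PauliString n, U * p.op * U⁻¹ ∈ pauliGroup n) : U ∈ cliffordGroup n := by
  have : Finite (pauliGroup n) := Finite.of_equiv _ (pauliEquiv n).toEquiv
  refine Subgroup.mem_normalizer_fintype (S := (pauliGroup n : Set (Ortho n))) fun P hP => ?_
  obtain ⟨p, hp⟩ := (pauliEquiv n).surjective ⟨P, hP⟩
  rw [← show p.op = P from congr_arg Subtype.val hp]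
  exact hU p

theorem neg_one_mem_cliffordGroup (n : ℕ) : (-1 : Ortho n) ∈ cliffordGroup n :=
  mem_cliffordGroup_of_forall_op fun p => by
    simpa only [neg_conj, inv_one, one_mul, mul_one] using op_mem_pauliGroup p

theorem Circuit.op_mem {n : ℕ} (w : Circuit n) : w.op ∈ cliffordGroup n :=
  mem_cliffordGroup_of_forall_op fun p => by
    rw [← w.op_act]
    exact op_mem_pauliGroup _

namespace NormalCircuit

variable {n : ℕ}

theorem op_eq_or_eq_neg (C : NormalCircuit n) :
    C.op = C.body.circuit.op ∨ C.op = -C.body.circuit.op :=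
  (ite_eq_or_eq _ _ _).symm

theorem op_mem_of_body_op_mem {C : NormalCircuit n} {S : Subgroup (Ortho n)} (neg_one : -1 ∈ S)
    (body : C.body.circuit.op ∈ S) : C.op ∈ S := by
  rcases C.op_eq_or_eq_neg with h | h <;> rw [h]
  · exact body
  · rw [← neg_one_mul]
    exact mul_mem neg_one body

theorem op_mem (C : NormalCircuit n) : C.op ∈ cliffordGroup n :=
  op_mem_of_body_op_mem (neg_one_mem_cliffordGroup n) C.body.circuit.op_mem

theorem op_neg (C : NormalCircuit n) : (-C).op = -C.op := by
  obtain ⟨_ | _, B⟩ := C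
  · rfl
  · exact (neg_neg _).symm

theorem body_eq_iff (C D : NormalCircuit n) : D.body = C.body ↔ D = C ∨ D = -C := by
  obtain ⟨s, B⟩ := C
  obtain ⟨t, B'⟩ := D
  rw [show -(⟨s, B⟩ : NormalCircuit n) = ⟨!s, B⟩ from rfl]
  cases s <;> cases t <;> simp

theorem conj_op (C : NormalCircuit n) (p : PauliString n) :
    C.op * p.op * C.op⁻¹ = (C.body.circuit.act p).op := by
  rw [Circuit.op_act]
  rcases C.op_eq_or_eq_neg with h | h <;> simp only [h, neg_conj]

theorem realizes_iff (C : NormalCircuit n) (φ : pauliGroup n ≃* pauliGroup n) :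
    C.Realizes φ ↔ C.body.circuit.act = MulAut.congr (pauliEquiv n).symm φ := by
  rw [Realizes, (pauliEquiv n).surjective.forall, MulEquiv.ext_iff]
  refine forall_congr' fun p => ?_
  rw [coe_pauliEquiv, C.conj_op, ← coe_pauliEquiv, ← Subtype.ext_iff,
    ← (pauliEquiv n).eq_symm_apply]
  rfl

end NormalCircuit

theorem exists_normalCircuit_realizes {n : ℕ} (φ : pauliGroup n ≃* pauliGroup n) :
    ∃ C : NormalCircuit n, C.Realizes φ ∧
      ∀ D : NormalCircuit n, D.Realizes φ ↔ D = C ∨ D = -C := by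
  obtain ⟨B, hB, unique⟩ := existsUnique_normalBody (MulAut.congr (pauliEquiv n).symm φ)
  refine ⟨⟨false, B⟩, (NormalCircuit.realizes_iff _ φ).2 hB, fun D => ?_⟩
  rw [← NormalCircuit.body_eq_iff, NormalCircuit.realizes_iff]
  exact ⟨unique D.body, fun h => h ▸ hB⟩

theorem existsUnique_normalCircuit {n : ℕ} {U : Ortho n} (hU : U ∈ cliffordGroup n) :
    ∃! C : NormalCircuit n, C.op = U := by
  obtain ⟨C, hC, realizes_iff⟩ :=
    exists_normalCircuit_realizes ((pauliGroup n).normalizerMonoidHom ⟨U, hU⟩)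
  have eq_or_eq_neg (D : NormalCircuit n) (hD : D.op = U) : D = C ∨ D = -C :=
    (realizes_iff D).1 fun P => by rw [hD]; rfl
  have op_eq : C.op = U ∨ C.op = -U :=
    eq_or_eq_neg_of_conj_op_eq fun p => hC (pauliEquiv n p)
  rcases op_eq with h | h
  · refine ⟨C, h, fun D hD => (eq_or_eq_neg D hD).resolve_right ?_⟩
    rintro rfl
    exact ortho_ne_neg C.op (h.trans (hD.symm.trans C.op_neg))
  · refine ⟨-C, C.op_neg.trans (neg_eq_iff_eq_neg.2 h),
      fun D hD => (eq_or_eq_neg D hD).resolve_left ?_⟩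
    rintro rfl
    exact ortho_ne_neg U (hD.symm.trans h)

theorem Circuit.op_mem_closure {n : ℕ} (w : Circuit n) :
    w.op ∈ Subgroup.closure (Set.range (Gate.op (n := n))) := by
  induction w with
  | nil => exact one_mem _
  | cons g w ih => exact mul_mem ih (Subgroup.subset_closure ⟨g, rfl⟩)

theorem closure_gates (n : ℕ) :
    Subgroup.closure ({-1} ∪ Set.range (Gate.op (n := n))) = cliffordGroup n := by
  refine le_antisymm ((Subgroup.closure_le _).2 ?_) fun U hU => ?_
  · rintro _ (rfl | ⟨g, rfl⟩)
    · exact neg_one_mem_cliffordGroup n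
    · simpa [Circuit.op] using Circuit.op_mem [g]
  · obtain ⟨C, rfl, -⟩ := existsUnique_normalCircuit hU
    exact NormalCircuit.op_mem_of_body_op_mem
      (Subgroup.subset_closure (Set.mem_union_left _ rfl))
      (Subgroup.closure_mono Set.subset_union_right C.body.circuit.op_mem_closure)

end RealClifford

theorem proposition4p15 (n : ℕ) :
    -- every automorphism is realized by a normal circuit, unique up to the scalar `±1`
    (∀ φ : RealClifford.pauliGroup n ≃* RealClifford.pauliGroup n,
      ∃ C : RealClifford.NormalCircuit n, C.Realizes φ ∧
        ∀ D : RealClifford.NormalCircuit n, D.Realizes φ ↔ D = C ∨ D = -C) ∧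
    -- the operators of normal circuits are Clifford operators
    (∀ C : RealClifford.NormalCircuit n, C.op ∈ RealClifford.cliffordGroup n) ∧
    -- every Clifford operator has a unique normal form
    (∀ U ∈ RealClifford.cliffordGroup n, ∃! C : RealClifford.NormalCircuit n, C.op = U) ∧
    -- the Clifford group is generated by `-1`, `H`, `Z` and `CZ`
    Subgroup.closure ({-1} ∪ Set.range (RealClifford.Gate.op (n := n))) =
      RealClifford.cliffordGroup n := by
  exact ⟨RealClifford.exists_normalCircuit_realizes, RealClifford.NormalCircuit.op_mem,
    fun _ hU => RealClifford.existsUnique_normalCircuit hU, RealClifford.closure_gates n⟩
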